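/- Let $\Delta$ be a finite set. A differential ring is a commutative ring with identity together with pairwise commuting derivations indexed by $\Delta$. Let $A$ be a Ritt algebra (a differential ring which is an algebra over $\mathbb{Q}$), and let $B$ be a differential ring which is an $A$-algebra whose structure homomorphism $A\to B$ (not necessarily injective) commutes with the derivations. Suppose that $B$ is an integral domain and is differentially finitely generated over $A$, i.e. there is a finite set $S\subseteq B$ such that the smallest $A$-subalgebra of $B$ containing $S$ and closed under all derivations is $B$ itself. Then there exists a nonzero element $s\in B$ such that the localization $B_s=B[1/s]$ has the form $B_s=C[Y]$, where $C\subseteq B_s$ is a finitely generated $A$-subalgebra and $Y\subseteq B_s$ is an at most countable set of elements algebraically independent over $C$. -/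

import Mathlib

/-- A differential ring with derivation operators indexed by `Δ`: a commutative ring together with
pairwise commuting derivations `δ i`, `i : Δ`. -/
class DeltaRing (Δ : Type*) (R : Type*) [CommRing R] where
  /-- The derivation operators. -/
  δ : Δ → Derivation ℤ R R
  /-- The derivation operators commute. -/
  δ_comm : ∀ (i j : Δ) (x : R), δ i (δ j x) = δ j (δ i x)

/-- The structure homomorphism of the `A`-algebra `B` is a differential homomorphism. -/
class DeltaAlgebra (Δ A B : Type*) [CommRing A] [CommRing B] [DeltaRing Δ A] [DeltaRing Δ B]
    [Algebra A B] : Prop where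
  δ_algebraMap : ∀ (i : Δ) (a : A),
    DeltaRing.δ i (algebraMap A B a) = algebraMap A B (DeltaRing.δ i a)

/-- `A{S}`: the smallest `A`-subalgebra of `B` that contains `S` and is closed under all the
derivation operators. -/
def DeltaAlgebra.adjoin (Δ A : Type*) {B : Type*} [CommRing A] [CommRing B] [DeltaRing Δ B]
    [Algebra A B] (S : Set B) : Subalgebra A B :=
  sInf {T : Subalgebra A B | S ⊆ T ∧ ∀ (i : Δ), ∀ x ∈ T, (DeltaRing.δ i x : B) ∈ T}

/-- `B` is differentially finitely generated over `A`: `B = A{S}` for some finite set `S`. -/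
def DeltaAlgebra.FiniteType (Δ A B : Type*) [CommRing A] [CommRing B] [DeltaRing Δ B]
    [Algebra A B] : Prop :=
  ∃ S : Set B, S.Finite ∧ DeltaAlgebra.adjoin Δ A S = ⊤

/-! This is Ritt's method. The derivatives `x i` of the generators are ranked by a well-order which
the derivations preserve and strictly increase. Let `P` index those transcendental over their
predecessors and `N` the others. The family over `P` is algebraically independent, and `B` is
algebraic over it. For `i ∈ N`, characteristic zero makes `x i` a simple root of a polynomial over
its predecessors. Differentiating that relation (`exists_separant`, `separant_mul_mem`) shows that
the separant times any proper derivative of `x i` is a polynomial in elements of lower rank. By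
Dickson's lemma `N` consists of derivatives of a finite `M ⊆ N`, so inverting the separants of `M`
eliminates `N \ M`. What remains is `P`, `M` and the inverses of finitely many separants. The last
two are algebraic over a finite part `F` of the independent family; moving `F` into `C` keeps the
rest independent. -/

/-! ### Algebraic independence and simple roots -/

open Set in
/-- A linearly ordered family is algebraically independent on a set `P` as soon as each member
indexed by `P` is transcendental over the algebra generated by its predecessors. -/
theorem algebraicIndepOn_of_transcendental_Iio {I R B : Type*} [LinearOrder I] [CommRing R]
    [CommRing B] [IsDomain B] [Algebra R B] [FaithfulSMul R B] {x : I → B} {P : Set I}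
    (h : ∀ i ∈ P, Transcendental (Algebra.adjoin R (x '' Iio i)) (x i)) :
    AlgebraicIndepOn R x P := by
  refine algebraicIndependent_of_finite_type fun t ht ↦ ?_
  suffices H : ∀ t : Finset I, (t : Set I) ⊆ P → AlgebraicIndepOn R x t from
    (H (ht.toFinset.image Subtype.val) (by rintro _ hi; simp at hi; exact hi.1)).comp
      (fun i : t ↦ ⟨i.1.1, by simp⟩) (fun a b hab ↦ by simpa [Subtype.ext_iff] using hab)
  intro t
  induction t using Finset.induction_on_max with
  | empty =>
    intro _
    have : IsEmpty ((∅ : Finset I) : Set I) := by simp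
    exact algebraicIndependent_empty_type_iff.2 (FaithfulSMul.algebraMap_injective R B)
  | insert a s hs ih =>
    intro hP
    rw [Finset.coe_insert] at hP ⊢
    refine (ih (subset_trans (subset_insert _ _) hP)).insert fun halg ↦
      h a (hP (mem_insert _ _)) (halg.adjoin_of_forall_isAlgebraic ?_)
    rintro _ ⟨⟨i, hi, rfl⟩, hn⟩
    exact absurd ⟨i, hs i hi, rfl⟩ hn

/-- Finitely many elements algebraic over the algebra generated by an algebraically independent set
`Y` can be adjoined to the base ring at the cost of moving finitely many elements of `Y` there. -/
theorem AlgebraicIndepOn.exists_finite_adjoin_union {R L : Type*} [CommRing R] [CommRing L]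
    [IsDomain L] [Algebra R L] [FaithfulSMul R L] {Y T : Set L} (hY : AlgebraicIndepOn R id Y)
    (hT : T.Finite) (hTY : ∀ a ∈ T, IsAlgebraic (Algebra.adjoin R Y) a) :
    ∃ F ⊆ Y, F.Finite ∧ AlgebraicIndependent (Algebra.adjoin R (F ∪ T))
      (fun y : ↥(Y \ F) ↦ (y : L)) := by
  -- Closure in the algebraic independence matroid is finitary, so finitely many elements of `Y`
  -- suffice for all of `T`.
  obtain ⟨F, hFY, hF, -, hTF⟩ :=
    (AlgebraicIndependent.matroid R L).exists_subset_finite_closure_of_subset_closure hT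
      (Y := Y) (by
        intro a ha
        rw [AlgebraicIndependent.matroid_closure_eq]
        exact hTY a ha)
  rw [AlgebraicIndependent.matroid_closure_eq] at hTF
  refine ⟨F, hFY, hF, ?_⟩
  have h1 := AlgebraicIndependent.adjoin_of_disjoint (x := fun y : Y ↦ (y : L)) hY
    (s := Subtype.val ⁻¹' F) (t := Subtype.val ⁻¹' (Y \ F))
    (Set.disjoint_left.2 fun a ha hb ↦ hb.2 ha)
  rw [Subtype.image_preimage_coe, Set.inter_eq_right.2 hFY] at h1
  have h2 : AlgebraicIndependent (Algebra.adjoin R F) (fun y : ↥(Y \ F) ↦ (y : L)) :=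
    h1.comp (fun y : ↥(Y \ F) ↦ ⟨⟨y, y.2.1⟩, y.2⟩) fun a b hab ↦ by
      simpa [Subtype.ext_iff] using hab
  -- `Y \ F` stays independent over the algebraic closure of `R[F]`, which contains `T`.
  let K := (Subalgebra.algebraicClosure (Algebra.adjoin R F) L).restrictScalars R
  have hle : Algebra.adjoin R (F ∪ T) ≤ K := by
    refine Algebra.adjoin_le (Set.union_subset (fun a ha ↦ ?_) hTF)
    exact isAlgebraic_algebraMap (⟨a, Algebra.subset_adjoin ha⟩ : Algebra.adjoin R F)
  exact AlgebraicIndependent.of_ringHom_of_comp_eq (Subalgebra.inclusion hle).toRingHom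
    (RingHom.id L) h2.subalgebraAlgebraicClosure (Subalgebra.inclusion_injective hle) rfl

open Polynomial in
/-- In characteristic zero, an algebraic element is a simple root of some polynomial. -/
theorem IsAlgebraic.exists_aeval_derivative_ne_zero {R B : Type*} [CommRing R] [CommRing B]
    [IsDomain R] [CharZero R] [Algebra R B] [FaithfulSMul R B] {b : B} (h : IsAlgebraic R b) :
    ∃ p : R[X], aeval b p = 0 ∧ aeval b (derivative p) ≠ 0 := by
  classical
  have hex : ∃ n, ∃ p : R[X], p ≠ 0 ∧ aeval b p = 0 ∧ p.natDegree = n := by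
    obtain ⟨p, hp, hpb⟩ := h
    exact ⟨_, p, hp, hpb, rfl⟩
  obtain ⟨p, hp, hpb, hn⟩ := Nat.find_spec hex
  -- `p` has minimal degree, so its nonzero derivative cannot also vanish at `b`.
  refine ⟨p, hpb, fun hd ↦ ?_⟩
  have hdeg : p.natDegree ≠ 0 := by
    intro h0
    rw [eq_C_of_natDegree_eq_zero h0, aeval_C,
      map_eq_zero_iff _ (FaithfulSMul.algebraMap_injective R B)] at hpb
    exact hp (by rw [eq_C_of_natDegree_eq_zero h0, hpb, C_0])
  refine Nat.find_min hex (hn ▸ natDegree_derivative_lt hdeg) ⟨_, fun h0 ↦ hdeg ?_, hd, rfl⟩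
  exact derivative_eq_zero.1 h0

/-! ### Rankings and separants -/

section Ranking

open Set

variable {Δ I R B : Type*} [LinearOrder I] [CommRing R] [CommRing B] [Algebra R B]
  {D : Δ → Derivation ℤ B B} {d : Δ → I → I} {x : I → B}

theorem Algebra.adjoin_image_Iio_mono {i j : I} (h : i ≤ j) :
    Algebra.adjoin R (x '' Iio i) ≤ Algebra.adjoin R (x '' Iio j) :=
  Algebra.adjoin_mono (image_mono (Iio_subset_Iio h))

theorem Algebra.adjoin_image_Iic_le {i j : I} (h : i < j) :
    Algebra.adjoin R (x '' Iic i) ≤ Algebra.adjoin R (x '' Iio j) :=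
  Algebra.adjoin_mono (image_mono fun _ hk ↦ lt_of_le_of_lt hk h)

/-- Derivations respect the filtration of the algebra by rank. -/
theorem Derivation.mem_adjoin_image_Iio
    (hD : ∀ k a, D k (algebraMap R B a) ∈ (algebraMap R B).range)
    (hx : ∀ k i, D k (x i) = x (d k i)) (hmono : ∀ k, StrictMono (d k)) (hlt : ∀ k i, i < d k i)
    (k : Δ) {i : I} {y : B} (hy : y ∈ Algebra.adjoin R (x '' Iio i)) :
    D k y ∈ Algebra.adjoin R (x '' Iio (d k i)) := by
  have hle := Algebra.adjoin_image_Iio_mono (R := R) (x := x) (hlt k i).le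
  induction hy using Algebra.adjoin_induction with
  | mem _ h =>
    obtain ⟨j, hj, rfl⟩ := h
    rw [hx]
    exact Algebra.subset_adjoin ⟨_, hmono k hj, rfl⟩
  | algebraMap a =>
    obtain ⟨c, hc⟩ := hD k a
    exact hc ▸ Subalgebra.algebraMap_mem _ c
  | add _ _ _ _ h1 h2 => rw [map_add]; exact add_mem h1 h2
  | mul _ _ h1 h2 h3 h4 =>
    rw [Derivation.leibniz]
    exact add_mem (mul_mem (hle h1) h4) (mul_mem (hle h2) h3)

open Polynomial in
/-- The separant is the coefficient of the derivative of the leader. -/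
theorem Derivation.aeval_sub_mem_adjoin_image_Iio
    (hD : ∀ k a, D k (algebraMap R B a) ∈ (algebraMap R B).range)
    (hx : ∀ k i, D k (x i) = x (d k i)) (hmono : ∀ k, StrictMono (d k)) (hlt : ∀ k i, i < d k i)
    (k : Δ) (i : I) (p : (Algebra.adjoin R (x '' Iio i))[X]) :
    D k (aeval (x i) p) - aeval (x i) (derivative p) * x (d k i) ∈
      Algebra.adjoin R (x '' Iio (d k i)) := by
  have hle := Algebra.adjoin_image_Iio_mono (R := R) (x := x) (hlt k i).le
  have hxi : x i ∈ Algebra.adjoin R (x '' Iio (d k i)) :=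
    Algebra.subset_adjoin ⟨i, hlt k i, rfl⟩
  induction p using Polynomial.induction_on' with
  | add p q hp hq =>
    convert! add_mem hp hq using 1
    simp only [map_add]
    ring
  | monomial n c =>
    have h1 := Derivation.mem_adjoin_image_Iio hD hx hmono hlt k c.2
    convert! mul_mem h1 (pow_mem hxi n) using 1
    rw [aeval_monomial, derivative_monomial, aeval_monomial, Derivation.leibniz,
      Derivation.leibniz_pow, hx, map_mul, _root_.map_natCast (algebraMap _ B)]
    simp only [smul_eq_mul, nsmul_eq_mul]
    change (c : B) * _ + _ * D k (c : B) - (c : B) * _ * _ * _ = _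
    ring

/-- A separant for an index `i` whose element is algebraic over its predecessors. -/
theorem exists_separant [IsDomain B] [CharZero B]
    (hD : ∀ k a, D k (algebraMap R B a) ∈ (algebraMap R B).range)
    (hx : ∀ k i, D k (x i) = x (d k i)) (hmono : ∀ k, StrictMono (d k)) (hlt : ∀ k i, i < d k i)
    {i : I} (hi : IsAlgebraic (Algebra.adjoin R (x '' Iio i)) (x i)) :
    ∃ s ∈ Algebra.adjoin R (x '' Iic i), s ≠ 0 ∧
      ∀ k, s * x (d k i) ∈ Algebra.adjoin R (x '' Iio (d k i)) := by
  obtain ⟨p, hp, hp'⟩ := hi.exists_aeval_derivative_ne_zero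
  refine ⟨_, ?_, hp', fun k ↦ ?_⟩
  · rw [Polynomial.aeval_eq_sum_range]
    refine sum_mem fun n _ ↦ ?_
    rw [Algebra.smul_def]
    exact mul_mem (Algebra.adjoin_mono (image_mono Iio_subset_Iic_self) (SetLike.coe_mem _))
      (pow_mem (Algebra.subset_adjoin (mem_image_of_mem x self_mem_Iic)) n)
  · simpa [hp] using Derivation.aeval_sub_mem_adjoin_image_Iio hD hx hmono hlt k i p

/-- The separant of `i` works for all iterated derivatives of `i`. -/
theorem separant_mul_mem
    (hD : ∀ k a, D k (algebraMap R B a) ∈ (algebraMap R B).range)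
    (hx : ∀ k i, D k (x i) = x (d k i)) (hmono : ∀ k, StrictMono (d k)) (hlt : ∀ k i, i < d k i)
    {i j : I} {s : B} (hs : s ∈ Algebra.adjoin R (x '' Iic i))
    (hsx : ∀ k, s * x (d k i) ∈ Algebra.adjoin R (x '' Iio (d k i)))
    (hij : Relation.TransGen (fun a b ↦ ∃ k, d k a = b) i j) :
    i < j ∧ s * x j ∈ Algebra.adjoin R (x '' Iio j) := by
  induction hij with
  | single h => obtain ⟨k, rfl⟩ := h; exact ⟨hlt k i, hsx k⟩
  | tail _ h ih =>
    obtain ⟨k, rfl⟩ := h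
    rename_i b _
    refine ⟨ih.1.trans (hlt k b), ?_⟩
    -- Differentiate `s * x b`: as `s` involves only ranks up to `i < b`, the term `x b * D k s`
    -- stays below `d k b` and can be subtracted.
    have h1 := Derivation.mem_adjoin_image_Iio hD hx hmono hlt k ih.2
    have h2 := Derivation.mem_adjoin_image_Iio hD hx hmono hlt k
      (Algebra.adjoin_image_Iic_le ih.1 hs)
    have h3 : x b ∈ Algebra.adjoin R (x '' Iio (d k b)) :=
      Algebra.subset_adjoin ⟨b, hlt k b, rfl⟩
    rw [Derivation.leibniz, hx] at h1
    simpa [mul_comm] using sub_mem h1 (mul_mem h3 h2)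

/-- Every member of a well-ordered family is algebraic over the algebra generated by those members
which are transcendental over their predecessors. -/
theorem isAlgebraic_adjoin_image_transcendental [WellFoundedLT I] [IsDomain B] (i : I) :
    IsAlgebraic (Algebra.adjoin R
      (x '' {j | Transcendental (Algebra.adjoin R (x '' Iio j)) (x j)})) (x i) := by
  induction i using WellFoundedLT.induction with
  | ind i ih =>
    by_cases hi : IsAlgebraic (Algebra.adjoin R (x '' Iio i)) (x i)
    · refine hi.adjoin_of_forall_isAlgebraic ?_
      rintro _ ⟨⟨j, hj, rfl⟩, -⟩
      exact ih j hj
    · exact isAlgebraic_algebraMap (⟨_, Algebra.subset_adjoin ⟨i, hi, rfl⟩⟩ : Algebra.adjoin R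
        (x '' {j | Transcendental (Algebra.adjoin R (x '' Iio j)) (x j)}))

end Ranking

/-! ### The structure theorem for ranked generators -/

open Set in
/-- Structure theorem for a differential algebra whose generators, closed under the derivations, are
indexed by a well-order compatible with the derivations, and satisfy Dickson's lemma. -/
theorem exists_localization_eq_adjoin_algebraicIndependent {Δ I R B : Type*} [LinearOrder I]
    [WellFoundedLT I] [Countable I] [CommRing R] [CommRing B] [IsDomain B] [CharZero B]
    [Algebra R B] [FaithfulSMul R B] {D : Δ → Derivation ℤ B B} {d : Δ → I → I} {x : I → B}
    (hD : ∀ k a, D k (algebraMap R B a) ∈ (algebraMap R B).range)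
    (hx : ∀ k i, D k (x i) = x (d k i)) (hmono : ∀ k, StrictMono (d k)) (hlt : ∀ k i, i < d k i)
    (hfin : ∀ N : Set I, ∃ M ⊆ N, M.Finite ∧
      ∀ i ∈ N, ∃ u ∈ M, Relation.ReflTransGen (fun a b ↦ ∃ k, d k a = b) u i)
    (hgen : Algebra.adjoin R (range x) = ⊤) :
    ∃ s : B, s ≠ 0 ∧
      ∃ C : Subalgebra R (Localization.Away s), C.FG ∧
        ∃ Y : Set (Localization.Away s), Y.Countable ∧
          AlgebraicIndependent C (fun y : Y => (y : Localization.Away s)) ∧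
          Algebra.adjoin C Y = ⊤ := by
  set N : Set I := {i | IsAlgebraic (Algebra.adjoin R (x '' Iio i)) (x i)}
  obtain ⟨M, hMN, hM, hMgen⟩ := hfin N
  choose! σ hσ hσ0 hσx using fun i (hi : i ∈ N) ↦ exists_separant hD hx hmono hlt hi
  let s : B := ∏ u ∈ hM.toFinset, σ u
  have hs0 : s ≠ 0 := Finset.prod_ne_zero_iff.2 fun u hu ↦ hσ0 u (hMN (hM.mem_toFinset.1 hu))
  refine ⟨s, hs0, ?_⟩
  set L := Localization.Away s
  have hpow : Submonoid.powers s ≤ nonZeroDivisors B :=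
    powers_le_nonZeroDivisors_of_noZeroDivisors hs0
  have hinj : Function.Injective (algebraMap B L) := IsLocalization.injective L hpow
  have : IsDomain L := IsLocalization.isDomain_localization hpow
  have : FaithfulSMul R L := (faithfulSMul_iff_algebraMap_injective R L).2 (by
    rw [IsScalarTower.algebraMap_eq R B L]
    exact hinj.comp (FaithfulSMul.algebraMap_injective R B))
  -- `Ring.inverse` is zero off the units; only `u ∈ M` matters, where `σ u` divides the unit `s`.
  let v : I → L := fun u ↦ Ring.inverse (algebraMap B L (σ u))
  have hv : ∀ u ∈ M, v u * algebraMap B L (σ u) = 1 := fun u hu ↦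
    Ring.inverse_mul_cancel _ <| isUnit_of_dvd_unit
      (map_dvd _ (Finset.dvd_prod_of_mem σ (hM.mem_toFinset.2 hu)))
      (IsLocalization.Away.algebraMap_isUnit s)
  let y : I → L := fun i ↦ algebraMap B L (x i)
  let P : Set I := {j | Transcendental (Algebra.adjoin R (x '' Iio j)) (x j)}
  have hind : AlgebraicIndepOn R id (y '' P) := by
    have h1 : AlgebraicIndepOn R x P := algebraicIndepOn_of_transcendental_Iio fun i hi ↦ hi
    exact (AlgebraicIndependent.map' (f := IsScalarTower.toAlgHom R B L) h1
      hinj).to_subtype_range' (by ext; simp [y])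
  have halg : ∀ a : L, IsAlgebraic (Algebra.adjoin R (y '' P)) a := by
    let G := Algebra.adjoin R (x '' P)
    have hGB : Algebra.IsAlgebraic G B := ⟨fun b ↦ by
      have hle : Algebra.adjoin R (range x) ≤
          (Subalgebra.algebraicClosure G B).restrictScalars R :=
        Algebra.adjoin_le (range_subset_iff.2 isAlgebraic_adjoin_image_transcendental)
      exact hle (hgen ▸ Algebra.mem_top)⟩
    have hBL : Algebra.IsAlgebraic B L :=
      IsLocalization.isAlgebraic L (Submonoid.powers s)
    have hGL : Algebra.IsAlgebraic G L := Algebra.IsAlgebraic.trans G B L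
    have hmap : G.map (IsScalarTower.toAlgHom R B L) = Algebra.adjoin R (y '' P) := by
      rw [AlgHom.map_adjoin, image_image]; rfl
    intro a
    have hf : ∀ g : G, algebraMap B L g ∈ Algebra.adjoin R (y '' P) := fun g ↦
      hmap ▸ ⟨g, g.2, rfl⟩
    exact (hGL.isAlgebraic a).ringHom_of_comp_eq
      (((algebraMap B L).comp G.val.toRingHom).codRestrict (Algebra.adjoin R (y '' P)) hf)
      (RingHom.id L) (fun g h hgh ↦ Subtype.ext (hinj (congrArg Subtype.val hgh))) rfl
  obtain ⟨F, hFP, hF, hY⟩ := hind.exists_finite_adjoin_union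
    ((hM.image y).union (hM.image v)) fun a _ ↦ halg a
  refine ⟨_, Subalgebra.fg_def.2 ⟨_, hF.union ((hM.image y).union (hM.image v)), rfl⟩,
    y '' P \ F, (P.to_countable.image y).mono sdiff_subset, hY, ?_⟩
  set C := Algebra.adjoin R (F ∪ (y '' M ∪ v '' M))
  let E := (Algebra.adjoin C (y '' P \ F)).restrictScalars R
  have hC : ∀ a ∈ F ∪ (y '' M ∪ v '' M), a ∈ E := fun a ha ↦
    Subalgebra.algebraMap_mem (Algebra.adjoin C (y '' P \ F)) ⟨a, Algebra.subset_adjoin ha⟩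
  have hv' : ∀ u ∈ M, v u ∈ E := fun u hu ↦ hC _ (.inr (.inr ⟨u, hu, rfl⟩))
  -- Induction on rank: a proper derivative of some `u ∈ M` is `v u` times a polynomial in lower
  -- elements.
  have hyE : ∀ i, x i ∈ E.comap (IsScalarTower.toAlgHom R B L) := by
    intro i
    induction i using WellFoundedLT.induction with
    | ind i ih =>
      by_cases hi : i ∈ N
      · obtain ⟨u, hu, hui⟩ := hMgen i hi
        rcases Relation.reflTransGen_iff_eq_or_transGen.1 hui with rfl | hui
        · exact hC _ (.inr (.inl ⟨_, hu, rfl⟩))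
        · have h1 := (separant_mul_mem hD hx hmono hlt (hσ u (hMN hu)) (hσx u (hMN hu)) hui).2
          have h2 : Algebra.adjoin R (x '' Iio i) ≤ E.comap (IsScalarTower.toAlgHom R B L) :=
            Algebra.adjoin_le (by rintro _ ⟨j, hj, rfl⟩; exact ih j hj)
          have h3 : v u * algebraMap B L (σ u * x i) ∈ E := mul_mem (hv' u hu) (h2 h1)
          rwa [map_mul, ← mul_assoc, hv u hu, one_mul] at h3
      · by_cases hiF : y i ∈ F
        · exact hC _ (.inl hiF)
        · exact Algebra.subset_adjoin (R := C) (s := y '' P \ F) ⟨⟨i, hi, rfl⟩, hiF⟩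
  have hBE : ∀ b, algebraMap B L b ∈ E := fun b ↦
    (hgen ▸ Algebra.adjoin_le (range_subset_iff.2 hyE) :
      ⊤ ≤ E.comap (IsScalarTower.toAlgHom R B L)) (Algebra.mem_top (x := b))
  have hinv : (∏ u ∈ hM.toFinset, v u) * algebraMap B L s = 1 := by
    rw [map_prod, ← Finset.prod_mul_distrib]
    exact Finset.prod_eq_one fun u hu ↦ hv u (hM.mem_toFinset.1 hu)
  refine eq_top_iff.2 fun a _ ↦ ?_
  obtain ⟨n, b, hb⟩ := IsLocalization.Away.surj s a
  have ha : a = algebraMap B L b * (∏ u ∈ hM.toFinset, v u) ^ n := by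
    rw [← hb, mul_assoc, ← mul_pow, mul_comm (algebraMap B L s), hinv, one_pow, mul_one]
  rw [ha]
  exact mul_mem (hBE b) (pow_mem (prod_mem fun u hu ↦ hv' u (hM.mem_toFinset.1 hu)) n)

/-! ### Change of base ring -/

/-- Being a polynomial algebra over a finitely generated subalgebra only depends on the image of the
base ring. -/
theorem Subalgebra.exists_fg_algebraicIndependent_of_surjective {A R L : Type*} [CommRing A]
    [CommRing R] [CommRing L] [Algebra A R] [Algebra A L] [Algebra R L] [IsScalarTower A R L]
    (hsurj : Function.Surjective (algebraMap A R)) {C : Subalgebra R L} (hC : C.FG) {Y : Set L}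
    (hind : AlgebraicIndependent C (fun y : Y => (y : L))) (hCY : Algebra.adjoin C Y = ⊤) :
    ∃ C' : Subalgebra A L, C'.FG ∧ AlgebraicIndependent C' (fun y : Y => (y : L)) ∧
      Algebra.adjoin C' Y = ⊤ := by
  refine ⟨C.restrictScalars A, ?_, hind, hCY⟩
  obtain ⟨t, rfl⟩ := hC
  refine ⟨t, le_antisymm (Algebra.adjoin_le Algebra.subset_adjoin) fun y hy ↦ ?_⟩
  rw [Subalgebra.mem_restrictScalars] at hy
  induction hy using Algebra.adjoin_induction with
  | mem _ h => exact Algebra.subset_adjoin h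
  | algebraMap r =>
    obtain ⟨a, rfl⟩ := hsurj r
    rw [← IsScalarTower.algebraMap_apply]
    exact Subalgebra.algebraMap_mem _ a
  | add _ _ _ _ h1 h2 => exact add_mem h1 h2
  | mul _ _ _ _ h1 h2 => exact mul_mem h1 h2

/-- The structure theorem only depends on the image of the base ring. -/
theorem exists_localization_of_surjective {A R B : Type*} [CommRing A] [CommRing R] [CommRing B]
    [Algebra A R] [Algebra A B] [Algebra R B] [IsScalarTower A R B]
    (hsurj : Function.Surjective (algebraMap A R))
    (h : ∃ s : B, s ≠ 0 ∧
      ∃ C : Subalgebra R (Localization.Away s), C.FG ∧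
        ∃ Y : Set (Localization.Away s), Y.Countable ∧
          AlgebraicIndependent C (fun y : Y => (y : Localization.Away s)) ∧
          Algebra.adjoin C Y = ⊤) :
    ∃ s : B, s ≠ 0 ∧
      ∃ C : Subalgebra A (Localization.Away s), C.FG ∧
        ∃ Y : Set (Localization.Away s), Y.Countable ∧
          AlgebraicIndependent C (fun y : Y => (y : Localization.Away s)) ∧
          Algebra.adjoin C Y = ⊤ := by
  obtain ⟨s, hs, C, hC, Y, hY, hind, hCY⟩ := h
  obtain ⟨C', hC', h1, h2⟩ :=
    Subalgebra.exists_fg_algebraicIndependent_of_surjective hsurj hC hind hCY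
  exact ⟨s, hs, C', hC', Y, hY, h1, h2⟩

/-! ### Dickson's lemma and the ranking of derivatives -/

open Finsupp in
/-- Dickson's lemma for exponents of derivatives of finitely many generators. -/
theorem MonomialOrder.exists_finite_reflTransGen {Δ : Type*} [Finite Δ] (m : MonomialOrder Δ)
    {n : ℕ} (N : Set (m.syn ×ₗ Fin n)) :
    ∃ M ⊆ N, M.Finite ∧ ∀ i ∈ N, ∃ u ∈ M, Relation.ReflTransGen
      (fun a b ↦ ∃ k, toLex (m.toSyn (single k 1) + (ofLex a).1, (ofLex a).2) = b) u i := by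
  classical
  let f : (Δ →₀ ℕ) → Fin n → m.syn ×ₗ Fin n := fun θ j ↦ toLex (m.toSyn θ, j)
  let Q : Fin n → (Δ →₀ ℕ) → Prop := fun j θ ↦ f θ j ∈ N
  -- For each generator, the minimal exponents in `N` form an antichain in `Δ →₀ ℕ`, hence a finite
  -- set.
  refine ⟨⋃ j, (f · j) '' {θ | Minimal (Q j) θ}, ?_, Set.finite_iUnion fun j ↦
    (WellQuasiOrderedLE.finite_of_isAntichain
      (setOfPred_minimal_antichain (Q j))).image _, fun i hi ↦ ?_⟩
  · rintro _ ⟨_, ⟨j, rfl⟩, θ, hθ, rfl⟩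
    exact hθ.prop
  have key : ∀ (j : Fin n) (θ : Δ →₀ ℕ) (c : Multiset Δ), Relation.ReflTransGen
      (fun a b ↦ ∃ k, toLex (m.toSyn (single k 1) + (ofLex a).1, (ofLex a).2) = b)
      (f θ j) (f (θ + c.toFinsupp) j) := by
    intro j θ c
    induction c using Multiset.induction with
    | empty => rw [map_zero, add_zero]
    | cons k c ih =>
      refine ih.tail ⟨k, ?_⟩
      rw [← Multiset.singleton_add, map_add, Multiset.toFinsupp_singleton, add_left_comm]
      simp [f]
  obtain ⟨θ, hθ⟩ := m.toSyn.surjective (ofLex i).1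
  have hfi : f θ (ofLex i).2 = i := by simp [f, hθ]
  obtain ⟨μ, hμθ, hμ⟩ := exists_minimal_le_of_wellFoundedLT (Q (ofLex i).2) θ (by
    change f θ (ofLex i).2 ∈ N
    rwa [hfi])
  refine ⟨_, Set.mem_iUnion.2 ⟨(ofLex i).2, μ, hμ, rfl⟩, ?_⟩
  obtain ⟨ν, rfl⟩ := exists_add_of_le hμθ
  have h := key (ofLex i).2 μ (toMultiset ν)
  rwa [Finsupp.toMultiset_toFinsupp, hfi] at h

/-- If the derivations preserve the image of `R` and the set `T`, the `R`-algebra generated by `T`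
contains the differential `A`-algebra generated by any subset of `T`. -/
theorem DeltaAlgebra.adjoin_le_restrictScalars {Δ A B R : Type*} [CommRing A] [CommRing B]
    [CommRing R] [Algebra A B] [Algebra A R] [Algebra R B] [IsScalarTower A R B] [DeltaRing Δ B]
    (hD : ∀ (k : Δ) a, DeltaRing.δ k (algebraMap R B a) ∈ (algebraMap R B).range) {S T : Set B}
    (hST : S ⊆ T) (hT : ∀ k : Δ, ∀ t ∈ T, DeltaRing.δ k t ∈ T) :
    DeltaAlgebra.adjoin Δ A S ≤ (Algebra.adjoin R T).restrictScalars A := by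
  refine sInf_le ⟨hST.trans Algebra.subset_adjoin, fun k y hy ↦ ?_⟩
  rw [Subalgebra.mem_restrictScalars] at hy ⊢
  induction hy using Algebra.adjoin_induction with
  | mem t ht => exact Algebra.subset_adjoin (hT k t ht)
  | algebraMap a =>
    obtain ⟨c, hc⟩ := hD k a
    exact hc ▸ Subalgebra.algebraMap_mem _ c
  | add _ _ _ _ h1 h2 => rw [map_add]; exact add_mem h1 h2
  | mul _ _ h1 h2 h3 h4 =>
    rw [Derivation.leibniz]
    exact add_mem (mul_mem h1 h4) (mul_mem h2 h3)

theorem mainTheorem6 {Δ A B : Type*} [Finite Δ] [CommRing A] [CommRing B] [IsDomain B]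
    [Algebra ℚ A] [Algebra A B] [DeltaRing Δ A] [DeltaRing Δ B] [DeltaAlgebra Δ A B]
    (hB : DeltaAlgebra.FiniteType Δ A B) :
    ∃ s : B, s ≠ 0 ∧
      ∃ C : Subalgebra A (Localization.Away s), C.FG ∧
        ∃ Y : Set (Localization.Away s), Y.Countable ∧
          AlgebraicIndependent C (fun y : Y => (y : Localization.Away s)) ∧
          Algebra.adjoin C Y = ⊤ := by
  classical
  obtain ⟨S, hS, hSB⟩ := hB
  obtain ⟨n, b, rfl⟩ := hS.fin_embedding
  have : CharZero B :=
    letI := ((algebraMap A B).comp (algebraMap ℚ A)).toAlgebra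
    algebraRat.charZero B
  obtain ⟨_⟩ := nonempty_fintype Δ
  let _ : LinearOrder Δ := LinearOrder.lift' (Fintype.equivFin Δ) (Fintype.equivFin Δ).injective
  let m : MonomialOrder Δ := MonomialOrder.degLex
  have : Countable (m.syn ×ₗ Fin n) :=
    ((m.toSyn.symm.toEquiv.prodCongr (Equiv.refl (Fin n))).injective.comp
      ofLex.injective).countable
  -- Commutation of the derivations makes the fold over a multiset in `x` well defined.
  have hcomm : LeftCommutative fun (k : Δ) (y : B) ↦ DeltaRing.δ k y := ⟨DeltaRing.δ_comm⟩
  let d : Δ → m.syn ×ₗ Fin n → m.syn ×ₗ Fin n := fun k i ↦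
    toLex (m.toSyn (Finsupp.single k 1) + (ofLex i).1, (ofLex i).2)
  let x : m.syn ×ₗ Fin n → B := fun i ↦
    (Finsupp.toMultiset (m.toSyn.symm (ofLex i).1)).foldr (fun k y ↦ DeltaRing.δ k y)
      (b (ofLex i).2)
  have hx : ∀ k i, DeltaRing.δ k (x i) = x (d k i) := fun k i ↦ by simp [x, d]
  have hlt : ∀ k i, i < d k i := fun k i ↦ Prod.Lex.lt_iff.2 <| .inl <|
    lt_add_of_pos_left _ (m.toSyn_lt_iff_ne_zero.2 (by simp))
  have hmono : ∀ k, StrictMono (d k) := fun k i j hij ↦ by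
    rcases Prod.Lex.lt_iff.1 hij with h | ⟨h1, h2⟩
    · exact Prod.Lex.lt_iff.2 (.inl (by simpa [d] using h))
    · exact Prod.Lex.lt_iff.2 (.inr ⟨by simp [d, h1], h2⟩)
  -- `A → B` may have a kernel, so the base is replaced by its image, which acts faithfully.
  let R : Subalgebra A B := ⊥
  have hD : ∀ (k : Δ) a, DeltaRing.δ k (algebraMap R B a) ∈ (algebraMap R B).range := by
    rintro k ⟨_, a, rfl⟩
    exact ⟨algebraMap A R (DeltaRing.δ k a), (DeltaAlgebra.δ_algebraMap (B := B) k a).symm⟩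
  have hgen : Algebra.adjoin R (Set.range x) = ⊤ := eq_top_iff.2 fun y _ ↦
    DeltaAlgebra.adjoin_le_restrictScalars (A := A) hD (S := Set.range b)
      (T := Set.range x) (by rintro _ ⟨j, rfl⟩; exact ⟨toLex (0, j), by simp [x]⟩)
      (by rintro k _ ⟨i, rfl⟩; exact ⟨d k i, (hx k i).symm⟩) (hSB ▸ Algebra.mem_top)
  exact exists_localization_of_surjective (A := A) (R := R)
    (by rintro ⟨_, a, rfl⟩; exact ⟨a, rfl⟩)
    (exists_localization_eq_adjoin_algebraicIndependent hD hx hmono hlt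
      (fun N ↦ m.exists_finite_reflTransGen N) hgen)
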